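/- Let $P=\{x\in\mathbb{R}^2:\langle x,\nu_k\rangle-c_k\ge 0,\ k=1,\dots,m\}$ be a polytope (possibly unbounded) and let $u:\operatorname{int}(P)\to\mathbb{R}$ be a smooth function with positive definite Hessian $(u_{ij})$, whose inverse is denoted by $(u^{ij})$. Let $$g_K=\sum_{i,j=1}^2\left(u_{ij}\,dx_i\otimes dx_j+u^{ij}\,d\theta_i\otimes d\theta_j\right),\qquad \omega=dx_1\wedge d\theta_1+dx_2\wedge d\theta_2$$ be the toric Kähler metric with symplectic potential $u$ in action-angle coordinates $(x,\theta)$ over $\operatorname{int}(P)$, with complex structure $J\partial_{x_i}=\sum_j u_{ij}\partial_{\theta_j}$, $J\partial_{\theta_i}=-\sum_j u^{ij}\partial_{x_j}$. Let $\mathrm{scal}(g_K)$ be its scalar curvature, which does not depend on $\theta$ and is therefore a function on $\operatorname{int}(P)$. Assume that $g_K$ is extremal (the $(1,0)$-part of the gradient of $\mathrm{scal}(g_K)$ is holomorphic, i.e. the gradient of $\mathrm{scal}(g_K)$ preserves $J$), that $g_K$ is Bach-flat, that $\mathrm{scal}(g_K)$ vanishes nowhere on $\operatorname{int}(P)$,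 and that the conformal metric $g_K/\mathrm{scal}^2(g_K)$ is Ricci-flat. Then the function $$\rho=\frac{(\det \operatorname{Hess} u)^{-1/2}}{\mathrm{scal}^2(g_K)}$$ is smooth on $\operatorname{int}(P)$ and harmonic there for the metric $g_{\mathbb{R}}=\sum_{i,j=1}^2u_{ij}\,dx_i\otimes dx_j$, that is, $$\frac{1}{\sqrt{\det\operatorname{Hess}u}}\sum_{i,j=1}^2\frac{\partial}{\partial x_i}\left(\sqrt{\det\operatorname{Hess}u}\;u^{ij}\,\frac{\partial\rho}{\partial x_j}\right)=0 .$$ -/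

import Mathlib

open scoped ContDiff

namespace ToricKahler

noncomputable section

/-! ### Riemannian geometry in a coordinate chart

A metric on an open set of `ℝ^ι` is given by its matrix of components `g x i j`. -/

section Chart

variable {ι : Type} [Fintype ι] [DecidableEq ι]

/-- The partial derivative `∂f/∂x_i`. -/
def pd (i : ι) (f : (ι → ℝ) → ℝ) (x : ι → ℝ) : ℝ :=
  fderiv ℝ f x (Pi.single i 1)

/-- The Hessian matrix `(∂²f/∂x_i∂x_j)`. -/
def hess (f : (ι → ℝ) → ℝ) (x : ι → ℝ) : Matrix ι ι ℝ :=
  Matrix.of fun i j => pd i (pd j f) x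

/-- The Christoffel symbols `Γ^k_{ij}` of the Levi-Civita connection of `g`. -/
def christoffel (g : (ι → ℝ) → Matrix ι ι ℝ) (k i j : ι) (x : ι → ℝ) : ℝ :=
  (1 / 2) * ∑ l, (g x)⁻¹ k l *
    (pd i (fun y => g y j l) x + pd j (fun y => g y i l) x - pd l (fun y => g y i j) x)

/-- The curvature `R(∂_i, ∂_j) ∂_k = ∑_l riemannUp g l k i j ∂_l`, where
`R(X, Y) = [∇_X, ∇_Y] - ∇_[X,Y]`. -/
def riemannUp (g : (ι → ℝ) → Matrix ι ι ℝ) (l k i j : ι) (x : ι → ℝ) : ℝ :=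
  pd i (christoffel g l j k) x - pd j (christoffel g l i k) x
    + ∑ m, (christoffel g l i m x * christoffel g m j k x
        - christoffel g l j m x * christoffel g m i k x)

/-- The Ricci tensor: `Ric(∂_j, ∂_k)` is the trace of `X ↦ R(X, ∂_j) ∂_k`. -/
def ricci (g : (ι → ℝ) → Matrix ι ι ℝ) (j k : ι) (x : ι → ℝ) : ℝ :=
  ∑ i, riemannUp g i k i j x

/-- The scalar curvature, the metric trace of the Ricci tensor. -/
def scal (g : (ι → ℝ) → Matrix ι ι ℝ) (x : ι → ℝ) : ℝ :=
  ∑ j, ∑ k, (g x)⁻¹ j k * ricci g j k x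

/-- The metric `g` is Ricci-flat on `U`. -/
def IsRicciFlatOn (g : (ι → ℝ) → Matrix ι ι ℝ) (U : Set (ι → ℝ)) : Prop :=
  ∀ x ∈ U, ∀ i j, ricci g i j x = 0

/-- The Riemann tensor with lowered indices, `R_{ijkl} = ⟨R(∂_i, ∂_j) ∂_l, ∂_k⟩`, so that
`R_{ijkl} = g_{ik} g_{jl} - g_{il} g_{jk}` on the unit sphere and `Ric_{jl} = g^{ik} R_{ijkl}`. -/
def riemann (g : (ι → ℝ) → Matrix ι ι ℝ) (i j k l : ι) (x : ι → ℝ) : ℝ :=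
  ∑ m, g x k m * riemannUp g m l i j x

/-- The Weyl tensor `W_{ijkl}` of a metric in dimension four; the argument `I` lists the four
indices. -/
def weyl (g : (ι → ℝ) → Matrix ι ι ℝ) (I : Fin 4 → ι) (x : ι → ℝ) : ℝ :=
  riemann g (I 0) (I 1) (I 2) (I 3) x
    - (1 / 2) * (g x (I 0) (I 2) * ricci g (I 1) (I 3) x - g x (I 0) (I 3) * ricci g (I 1) (I 2) x
        - g x (I 1) (I 2) * ricci g (I 0) (I 3) x + g x (I 1) (I 3) * ricci g (I 0) (I 2) x)
    + (scal g x / 6) * (g x (I 0) (I 2) * g x (I 1) (I 3) - g x (I 0) (I 3) * g x (I 1) (I 2))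

/-- The covariant derivative of a covariant tensor field `T` of rank `r`; the first index of the
result is the direction of differentiation. -/
def covDeriv {r : ℕ} (g : (ι → ℝ) → Matrix ι ι ℝ) (T : (Fin r → ι) → (ι → ℝ) → ℝ)
    (I : Fin (r + 1) → ι) (x : ι → ℝ) : ℝ :=
  pd (I 0) (T (Fin.tail I)) x
    - ∑ a, ∑ p, christoffel g p (I 0) (Fin.tail I a) x * T (Function.update (Fin.tail I) a p) x

/-- The Bach tensor of a metric in dimension four,
`B_{ij} = ∇^k ∇^l W_{ikjl} + (1/2) Ric^{kl} W_{ikjl}`. -/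
def bach (g : (ι → ℝ) → Matrix ι ι ℝ) (i j : ι) (x : ι → ℝ) : ℝ :=
  (∑ k, ∑ l, ∑ a, ∑ b, (g x)⁻¹ k a * (g x)⁻¹ l b *
      covDeriv g (covDeriv g (weyl g)) ![a, b, i, k, j, l] x)
    + (1 / 2) * ∑ k, ∑ l, ∑ a, ∑ b, (g x)⁻¹ k a * (g x)⁻¹ l b *
      ricci g a b x * weyl g ![i, k, j, l] x

/-- The metric `g` (in dimension four) is Bach-flat on `U`. -/
def IsBachFlatOn (g : (ι → ℝ) → Matrix ι ι ℝ) (U : Set (ι → ℝ)) : Prop :=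
  ∀ x ∈ U, ∀ i j, bach g i j x = 0

/-- The components of the gradient of `f` with respect to `g`. -/
def grad (g : (ι → ℝ) → Matrix ι ι ℝ) (f : (ι → ℝ) → ℝ) (i : ι) (x : ι → ℝ) : ℝ :=
  ∑ j, (g x)⁻¹ i j * pd j f x

/-- The Lie derivative `(L_V J)^i_j` of an endomorphism field `J ∂_j = ∑_i J^i_j ∂_i` along a
vector field `V = ∑_i V^i ∂_i`. -/
def lieDerivEnd (V : ι → (ι → ℝ) → ℝ) (J : (ι → ℝ) → Matrix ι ι ℝ) (i j : ι) (x : ι → ℝ) : ℝ :=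
  ∑ k, (V k x * pd k (fun y => J y i j) x - J x k j * pd k (V i) x + J x i k * pd j (V k) x)

/-- The Kähler metric `g` with complex structure `J` is extremal on `U`: the `(1,0)`-part of the
gradient of its scalar curvature is a holomorphic vector field, that is, the flow of the gradient
of the scalar curvature preserves `J`. -/
def IsExtremalOn (g J : (ι → ℝ) → Matrix ι ι ℝ) (U : Set (ι → ℝ)) : Prop :=
  ∀ x ∈ U, ∀ i j, lieDerivEnd (grad g (scal g)) J i j x = 0

/-- The Laplace–Beltrami operator of `g`. -/
def laplaceBeltrami (g : (ι → ℝ) → Matrix ι ι ℝ) (f : (ι → ℝ) → ℝ) (x : ι → ℝ) : ℝ :=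
  (1 / Real.sqrt (g x).det) *
    ∑ i, pd i (fun y => Real.sqrt (g y).det * grad g f i y) x

/-- The function `f` is harmonic on `U` for the metric `g`. -/
def IsHarmonicOn (g : (ι → ℝ) → Matrix ι ι ℝ) (f : (ι → ℝ) → ℝ) (U : Set (ι → ℝ)) : Prop :=
  ContDiffOn ℝ ∞ f U ∧ ∀ x ∈ U, laplaceBeltrami g f x = 0

end Chart

/-! ### Toric Kähler surfaces in action-angle coordinates

Action-angle coordinates `(x₁, x₂, θ₁, θ₂)` are indexed by `Fin 2 ⊕ Fin 2`, the action coordinates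
by the left summand and the angle coordinates by the right one. The angles run over `ℝ²`, the
universal cover of the torus. -/

/-- The polytope `{x ∈ ℝ² : ⟨x, ν_k⟩ - c_k ≥ 0 for all k}`. -/
def polytope {m : ℕ} (ν : Fin m → Fin 2 → ℝ) (c : Fin m → ℝ) : Set (Fin 2 → ℝ) :=
  {x | ∀ k, 0 ≤ x ⬝ᵥ ν k - c k}

/-- The moment map `(x, θ) ↦ x`. -/
def moment (p : Fin 2 ⊕ Fin 2 → ℝ) : Fin 2 → ℝ := fun i => p (Sum.inl i)

/-- The metric `g_K = ∑ u_{ij} dx_i ⊗ dx_j + u^{ij} dθ_i ⊗ dθ_j` with symplectic potential `u`. -/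
def toricMetric (u : (Fin 2 → ℝ) → ℝ) (p : Fin 2 ⊕ Fin 2 → ℝ) :
    Matrix (Fin 2 ⊕ Fin 2) (Fin 2 ⊕ Fin 2) ℝ :=
  Matrix.fromBlocks (hess u (moment p)) 0 0 (hess u (moment p))⁻¹

/-- The complex structure `J ∂_{x_i} = ∑_j u_{ij} ∂_{θ_j}`, `J ∂_{θ_i} = -∑_j u^{ij} ∂_{x_j}`; it is
determined by `g_K(J X, Y) = ω(X, Y)` with `ω = dx₁ ∧ dθ₁ + dx₂ ∧ dθ₂`. -/
def toricJ (u : (Fin 2 → ℝ) → ℝ) (p : Fin 2 ⊕ Fin 2 → ℝ) :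
    Matrix (Fin 2 ⊕ Fin 2) (Fin 2 ⊕ Fin 2) ℝ :=
  Matrix.fromBlocks 0 (-(hess u (moment p))⁻¹) (hess u (moment p)) 0

/-- The metric `g_ℝ = ∑ u_{ij} dx_i ⊗ dx_j` on the interior of the polytope. -/
def realMetric (u : (Fin 2 → ℝ) → ℝ) : (Fin 2 → ℝ) → Matrix (Fin 2) (Fin 2) ℝ := hess u

/-- The conformal metric `g / scal(g)²`. -/
def conformalMetric (g : (Fin 2 ⊕ Fin 2 → ℝ) → Matrix (Fin 2 ⊕ Fin 2) (Fin 2 ⊕ Fin 2) ℝ)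
    (p : Fin 2 ⊕ Fin 2 → ℝ) : Matrix (Fin 2 ⊕ Fin 2) (Fin 2 ⊕ Fin 2) ℝ :=
  (1 / scal g p ^ 2) • g p

/-- The scalar curvature of `g_K` as a function of the action coordinates; see `scal_toricMetric`
for its independence of the angles. -/
def toricScal (u : (Fin 2 → ℝ) → ℝ) (x : Fin 2 → ℝ) : ℝ :=
  scal (toricMetric u) (Sum.elim x 0)

/-- The function `ρ = (det Hess u)^{-1/2} / scal(g_K)²`. -/
def rho (u : (Fin 2 → ℝ) → ℝ) (x : Fin 2 → ℝ) : ℝ :=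
  (hess u x).det ^ (-(1 / 2) : ℝ) / toricScal u x ^ 2

section Invariance

variable {ι : Type} [Fintype ι] [DecidableEq ι]

theorem pd_add_const (i : ι) (f : (ι → ℝ) → ℝ) (v : ι → ℝ) (hf : ∀ x, f (x + v) = f x)
    (x : ι → ℝ) : pd i f (x + v) = pd i f x := by
  have h : (fun y => f (y + v)) = f := funext hf
  unfold pd
  rw [← fderiv_comp_add_right, h]

theorem scal_add_const (g : (ι → ℝ) → Matrix ι ι ℝ) (v : ι → ℝ) (hg : ∀ x, g (x + v) = g x)
    (x : ι → ℝ) : scal g (x + v) = scal g x := by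
  have h1 : ∀ k i j x, christoffel g k i j (x + v) = christoffel g k i j x := by
    intro k i j x
    have h : ∀ a b c, pd a (fun y => g y b c) (x + v) = pd a (fun y => g y b c) x :=
      fun a b c => pd_add_const a _ v (fun y => by rw [hg]) x
    simp only [christoffel, hg, h]
  have h2 : ∀ a k i j x, pd a (christoffel g k i j) (x + v) = pd a (christoffel g k i j) x :=
    fun a k i j x => pd_add_const a _ v (h1 k i j) x
  simp only [scal, ricci, riemannUp, hg, h1, h2]

/-- The scalar curvature of a toric metric does not depend on the angle coordinates. -/
theorem scal_toricMetric (u : (Fin 2 → ℝ) → ℝ) (p : Fin 2 ⊕ Fin 2 → ℝ) :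
    scal (toricMetric u) p = toricScal u (moment p) := by
  let v : Fin 2 ⊕ Fin 2 → ℝ := Sum.elim (fun _ => 0) (fun i => p (Sum.inr i))
  have hp : Sum.elim (moment p) 0 + v = p := by
    ext i
    rcases i with i | i <;> simp [moment, v]
  have hm : ∀ x, moment (x + v) = moment x := fun x => by
    ext i
    simp [moment, v]
  have h := scal_add_const (toricMetric u) v (fun x => by simp only [toricMetric, hm])
    (Sum.elim (moment p) 0)
  rw [hp] at h
  exact h

end Invariance

end

end ToricKahler

namespace ToricKahler

/-! With `φ = scal⁻²`, the conformal metric is `A dx² + B dθ²`, where `A = φ Hess u` and `B = φ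
(Hess u)⁻¹` do not depend on the angles. For any such metric, tracing the fibre block of the Ricci
tensor with `B⁻¹` gives `-r⁻¹ Δ_A r`, where `r = √det B` is the area density of the torus fibres.
Ricci-flatness therefore makes `r` harmonic for `A`.

In rank two, `det B = φ² / det Hess u`, so `r` is exactly `ρ`. In dimension two, harmonicity does
not see the conformal factor, so `A` may be replaced by `Hess u`.

The substance is in `ricci_blockMetric` (the fibre Ricci components) and
`laplaceBeltrami_eq_zero_of_ricci_eq_zero` (their trace); `sqrt_det_conformal_inv_hess` and
`laplaceBeltrami_smul` supply the last two observations. -/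

theorem pd_congr {ι : Type} [DecidableEq ι] {f h : (ι → ℝ) → ℝ} {x : ι → ℝ}
    (hfh : f =ᶠ[nhds x] h) (i : ι) : pd i f x = pd i h x := by
  rw [pd, pd, hfh.fderiv_eq]

theorem pd_const {ι : Type} [DecidableEq ι] (i : ι) (c : ℝ) (x : ι → ℝ) :
    pd i (fun _ => c) x = 0 := by
  simp [pd]

/-! ### Smoothness of the curvature quantities -/

section Smoothness

variable {ι : Type} [Fintype ι] [DecidableEq ι]

theorem contDiffAt_pd {f : (ι → ℝ) → ℝ} {x : ι → ℝ} (hf : ContDiffAt ℝ ∞ f x) (i : ι) :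
    ContDiffAt ℝ ∞ (pd i f) x :=
  (hf.fderiv_right (m := ∞) (by simp)).clm_apply contDiffAt_const

theorem contDiffAt_det {E : Type*} [NormedAddCommGroup E] [NormedSpace ℝ E]
    {g : E → Matrix ι ι ℝ} {x : E}
    (hg : ∀ i j, ContDiffAt ℝ ∞ (fun y => g y i j) x) :
    ContDiffAt ℝ ∞ (fun y => (g y).det) x := by
  simp only [Matrix.det_apply']
  exact ContDiffAt.sum fun σ _ => contDiffAt_const.mul (contDiffAt_prod fun i _ => hg _ _)

theorem contDiffAt_matrix_inv {E : Type*} [NormedAddCommGroup E] [NormedSpace ℝ E]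
    {g : E → Matrix ι ι ℝ} {x : E}
    (hg : ∀ i j, ContDiffAt ℝ ∞ (fun y => g y i j) x) (hdet : (g x).det ≠ 0) (i j : ι) :
    ContDiffAt ℝ ∞ (fun y => (g y)⁻¹ i j) x := by
  simp only [Matrix.inv_def, Ring.inverse_eq_inv', Matrix.smul_apply, smul_eq_mul,
    Matrix.adjugate_apply]
  refine ((contDiffAt_det hg).inv hdet).mul (contDiffAt_det fun a b => ?_)
  by_cases h : a = j
  · simp only [Matrix.updateRow_apply, h, if_true]
    exact contDiffAt_const
  · simp only [Matrix.updateRow_apply, h, if_false]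
    exact hg a b

variable {g : (ι → ℝ) → Matrix ι ι ℝ} {x : ι → ℝ}

theorem contDiffAt_christoffel (hg : ∀ i j, ContDiffAt ℝ ∞ (fun y => g y i j) x)
    (hdet : (g x).det ≠ 0) (k i j : ι) : ContDiffAt ℝ ∞ (christoffel g k i j) x :=
  contDiffAt_const.mul (ContDiffAt.sum fun l _ => (contDiffAt_matrix_inv hg hdet k l).mul
    (((contDiffAt_pd (hg j l) i).add (contDiffAt_pd (hg i l) j)).sub (contDiffAt_pd (hg i j) l)))

theorem contDiffAt_scal (hg : ∀ i j, ContDiffAt ℝ ∞ (fun y => g y i j) x)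
    (hdet : (g x).det ≠ 0) : ContDiffAt ℝ ∞ (scal g) x := by
  have hΓ := contDiffAt_christoffel hg hdet
  exact ContDiffAt.sum fun j _ => ContDiffAt.sum fun k _ =>
    (contDiffAt_matrix_inv hg hdet j k).mul (ContDiffAt.sum fun i _ =>
      ((contDiffAt_pd (hΓ _ _ _) _).sub (contDiffAt_pd (hΓ _ _ _) _)).add
        (ContDiffAt.sum fun m _ => ((hΓ _ _ _).mul (hΓ _ _ _)).sub ((hΓ _ _ _).mul (hΓ _ _ _))))

end Smoothness

/-! ### Calculus rules for partial derivatives -/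

section PartialDerivatives

variable {ι : Type} [Fintype ι] [DecidableEq ι] {f h : (ι → ℝ) → ℝ} {x : ι → ℝ}

theorem pd_add (hf : DifferentiableAt ℝ f x) (hh : DifferentiableAt ℝ h x) (i : ι) :
    pd i (fun y => f y + h y) x = pd i f x + pd i h x := by
  simp [pd, fderiv_fun_add hf hh]

theorem pd_sub (hf : DifferentiableAt ℝ f x) (hh : DifferentiableAt ℝ h x) (i : ι) :
    pd i (fun y => f y - h y) x = pd i f x - pd i h x := by
  simp [pd, fderiv_fun_sub hf hh]

theorem pd_mul (hf : DifferentiableAt ℝ f x) (hh : DifferentiableAt ℝ h x) (i : ι) :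
    pd i (fun y => f y * h y) x = pd i f x * h x + f x * pd i h x := by
  simp [pd, fderiv_fun_mul hf hh]
  ring

theorem pd_sum {κ : Type*} (s : Finset κ) {F : κ → (ι → ℝ) → ℝ}
    (hF : ∀ k ∈ s, DifferentiableAt ℝ (F k) x) (i : ι) :
    pd i (fun y => ∑ k ∈ s, F k y) x = ∑ k ∈ s, pd i (F k) x := by
  simp [pd, fderiv_fun_sum hF]

end PartialDerivatives

/-! ### Differentiating functions pulled back by the moment map -/

section Moment

theorem moment_eq_clm : ∃ M : (Fin 2 ⊕ Fin 2 → ℝ) →L[ℝ] (Fin 2 → ℝ), ∀ p, moment p = M p :=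
  ⟨ContinuousLinearMap.pi fun i => ContinuousLinearMap.proj (Sum.inl i), fun _ => rfl⟩

theorem contDiff_moment : ContDiff ℝ ∞ moment := by
  obtain ⟨M, hM⟩ := moment_eq_clm
  rw [funext hM]
  exact M.contDiff

theorem pd_comp_moment {f : (Fin 2 → ℝ) → ℝ} {p : Fin 2 ⊕ Fin 2 → ℝ}
    (hf : DifferentiableAt ℝ f (moment p)) (i : Fin 2 ⊕ Fin 2) :
    pd i (fun q => f (moment q)) p = fderiv ℝ f (moment p) (moment (Pi.single i 1)) := by
  obtain ⟨M, hM⟩ := moment_eq_clm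
  simp only [hM] at hf ⊢
  exact congrArg (· (Pi.single i 1)) (hf.hasFDerivAt.comp p M.hasFDerivAt).fderiv

theorem pd_inl_comp_moment {f : (Fin 2 → ℝ) → ℝ} {p : Fin 2 ⊕ Fin 2 → ℝ}
    (hf : DifferentiableAt ℝ f (moment p)) (i : Fin 2) :
    pd (Sum.inl i) (fun q => f (moment q)) p = pd i f (moment p) := by
  rw [pd_comp_moment hf, pd]
  congr 1
  ext j
  simp [moment, Pi.single_apply]

theorem pd_inr_comp_moment {f : (Fin 2 → ℝ) → ℝ} {p : Fin 2 ⊕ Fin 2 → ℝ}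
    (hf : DifferentiableAt ℝ f (moment p)) (i : Fin 2) :
    pd (Sum.inr i) (fun q => f (moment q)) p = 0 := by
  rw [pd_comp_moment hf]
  convert map_zero (fderiv ℝ f (moment p))
  ext j
  simp [moment]

end Moment

/-! ### Curvature of torus-invariant block metrics -/

section TorusInvariant

/-- The metric `∑ A_{ij} dx_i ⊗ dx_j + B_{ij} dθ_i ⊗ dθ_j` with coefficients that do not depend on
the angles. -/
def blockMetric (A B : (Fin 2 → ℝ) → Matrix (Fin 2) (Fin 2) ℝ) (p : Fin 2 ⊕ Fin 2 → ℝ) :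
    Matrix (Fin 2 ⊕ Fin 2) (Fin 2 ⊕ Fin 2) ℝ :=
  Matrix.fromBlocks (A (moment p)) 0 0 (B (moment p))

theorem inv_fromBlocks_diagonal {A B : Matrix (Fin 2) (Fin 2) ℝ} (hA : A.det ≠ 0)
    (hB : B.det ≠ 0) :
    (Matrix.fromBlocks A 0 0 B)⁻¹ = Matrix.fromBlocks A⁻¹ 0 0 B⁻¹ := by
  apply Matrix.inv_eq_right_inv
  rw [Matrix.fromBlocks_multiply]
  simp [Matrix.mul_nonsing_inv _ (isUnit_iff_ne_zero.2 hA),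
    Matrix.mul_nonsing_inv _ (isUnit_iff_ne_zero.2 hB), Matrix.fromBlocks_one]

variable {A B : (Fin 2 → ℝ) → Matrix (Fin 2) (Fin 2) ℝ} {p : Fin 2 ⊕ Fin 2 → ℝ}

/-- The reflection `θ ↦ -θ` is an isometry, so symbols with an odd number of angle indices vanish.
Among the others, only base derivatives of `A` and `B` survive. -/
theorem christoffel_blockMetric
    (hA : ∀ i j, DifferentiableAt ℝ (fun y => A y i j) (moment p))
    (hB : ∀ i j, DifferentiableAt ℝ (fun y => B y i j) (moment p))
    (hA0 : (A (moment p)).det ≠ 0) (hB0 : (B (moment p)).det ≠ 0) (i j k : Fin 2) :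
    christoffel (blockMetric A B) (Sum.inl k) (Sum.inl i) (Sum.inl j) p
        = christoffel A k i j (moment p) ∧
    christoffel (blockMetric A B) (Sum.inr k) (Sum.inl i) (Sum.inl j) p = 0 ∧
    christoffel (blockMetric A B) (Sum.inl k) (Sum.inl i) (Sum.inr j) p = 0 ∧
    christoffel (blockMetric A B) (Sum.inl k) (Sum.inr i) (Sum.inl j) p = 0 ∧
    christoffel (blockMetric A B) (Sum.inr k) (Sum.inr i) (Sum.inr j) p = 0 ∧
    christoffel (blockMetric A B) (Sum.inr k) (Sum.inl i) (Sum.inr j) p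
        = (1 / 2) * ∑ l, (B (moment p))⁻¹ k l * pd i (fun y => B y j l) (moment p) ∧
    christoffel (blockMetric A B) (Sum.inr k) (Sum.inr i) (Sum.inl j) p
        = (1 / 2) * ∑ l, (B (moment p))⁻¹ k l * pd j (fun y => B y i l) (moment p) ∧
    christoffel (blockMetric A B) (Sum.inl k) (Sum.inr i) (Sum.inr j) p
        = -(1 / 2) * ∑ l, (A (moment p))⁻¹ k l * pd l (fun y => B y i j) (moment p) := by
  have hinv : (blockMetric A B p)⁻¹ = Matrix.fromBlocks (A (moment p))⁻¹ 0 0 (B (moment p))⁻¹ :=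
    inv_fromBlocks_diagonal hA0 hB0
  simp only [christoffel, hinv, Fintype.sum_sum_type]
  simp only [blockMetric, Matrix.fromBlocks_apply₁₁, Matrix.fromBlocks_apply₁₂,
    Matrix.fromBlocks_apply₂₁, Matrix.fromBlocks_apply₂₂, Matrix.zero_apply, pd_const,
    pd_inl_comp_moment (hA _ _), pd_inl_comp_moment (hB _ _), pd_inr_comp_moment (hA _ _),
    pd_inr_comp_moment (hB _ _)]
  simp
  ring

/-- The terms of the fibre components of the Ricci tensor that do not vanish for symmetry
reasons. -/
theorem ricci_blockMetric {U : Set (Fin 2 → ℝ)} (hU : IsOpen U)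
    (hA : ∀ x ∈ U, ∀ i j, ContDiffAt ℝ ∞ (fun y => A y i j) x)
    (hB : ∀ x ∈ U, ∀ i j, ContDiffAt ℝ ∞ (fun y => B y i j) x)
    (hA0 : ∀ x ∈ U, (A x).det ≠ 0) (hB0 : ∀ x ∈ U, (B x).det ≠ 0) (hp : moment p ∈ U)
    (a b : Fin 2) :
    ricci (blockMetric A B) (Sum.inr a) (Sum.inr b) p
      = -(1 / 2) * ∑ i, ∑ j,
          (pd i (fun y => (A y)⁻¹ i j) (moment p) * pd j (fun y => B y a b) (moment p)
            + (A (moment p))⁻¹ i j * pd i (pd j (fun y => B y a b)) (moment p)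
            + ((∑ k, christoffel A k k i (moment p))
                + 1 / 2 * ∑ c, ∑ d, (B (moment p))⁻¹ c d * pd i (fun y => B y c d) (moment p))
              * ((A (moment p))⁻¹ i j * pd j (fun y => B y a b) (moment p))
            - 1 / 2 * (A (moment p))⁻¹ i j * ∑ c, ∑ d, (B (moment p))⁻¹ c d
              * (pd j (fun y => B y a c) (moment p) * pd i (fun y => B y b d) (moment p)
                + pd i (fun y => B y a d) (moment p) * pd j (fun y => B y c b) (moment p))) := by
  set x := moment p with hx
  have hV : moment ⁻¹' U ∈ nhds p := (hU.preimage contDiff_moment.continuous).mem_nhds hp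
  have hΓ : ∀ q, moment q ∈ U → ∀ i j k : Fin 2, _ := fun q hq i j k =>
    christoffel_blockMetric (fun i j => (hA _ hq i j).differentiableAt (by simp))
      (fun i j => (hB _ hq i j).differentiableAt (by simp)) (hA0 _ hq) (hB0 _ hq) i j k
  have hE : ∀ i j, ContDiffAt ℝ ∞ (fun y => (A y)⁻¹ i j) x := fun i j =>
    contDiffAt_matrix_inv (hA x hp) (hA0 x hp) i j
  -- The only derivative of a Christoffel symbol that contributes to the fibre block; those in `d2`
  -- and `d3` are of symbols that vanish identically over `U`.
  have d1 : ∀ i : Fin 2, pd (Sum.inl i)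
      (christoffel (blockMetric A B) (Sum.inl i) (Sum.inr a) (Sum.inr b)) p
      = -(1 / 2) * ∑ j, (pd i (fun y => (A y)⁻¹ i j) x * pd j (fun y => B y a b) x
          + (A x)⁻¹ i j * pd i (pd j (fun y => B y a b)) x) := by
    intro i
    have e : christoffel (blockMetric A B) (Sum.inl i) (Sum.inr a) (Sum.inr b) =ᶠ[nhds p]
        fun q => (fun y => -(1 / 2) * ∑ l, (A y)⁻¹ i l * pd l (fun y => B y a b) y) (moment q) := by
      filter_upwards [hV] with q hq
      exact (hΓ q hq a b i).2.2.2.2.2.2.2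
    have hs : ∀ j, DifferentiableAt ℝ (fun y => (A y)⁻¹ i j * pd j (fun y => B y a b) y) x :=
      fun j => ((hE i j).mul (contDiffAt_pd (hB x hp a b) j)).differentiableAt (by simp)
    have hS : DifferentiableAt ℝ (fun y => ∑ l, (A y)⁻¹ i l * pd l (fun y => B y a b) y) x :=
      DifferentiableAt.fun_sum fun j _ => hs j
    rw [pd_congr e, pd_inl_comp_moment ((differentiableAt_const _).fun_mul hS), ← hx,
      pd_mul (differentiableAt_const _) hS, pd_const, pd_sum _ fun j _ => hs j, zero_mul, zero_add]
    congr 1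
    refine Finset.sum_congr rfl fun j _ => ?_
    rw [pd_mul ((hE i j).differentiableAt (by simp))
      ((contDiffAt_pd (hB x hp a b) j).differentiableAt (by simp))]
  have d0 : ∀ (i : Fin 2 ⊕ Fin 2) {f : (Fin 2 ⊕ Fin 2 → ℝ) → ℝ},
      (∀ q, moment q ∈ U → f q = 0) → pd i f p = 0 := by
    intro i f hf
    have e : f =ᶠ[nhds p] fun _ => 0 := by
      filter_upwards [hV] with q hq
      exact hf q hq
    rw [pd_congr e, pd_const]
  have d2 : ∀ i : Fin 2, pd (Sum.inr a)
      (christoffel (blockMetric A B) (Sum.inl i) (Sum.inl i) (Sum.inr b)) p = 0 :=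
    fun i => d0 _ fun q hq => (hΓ q hq _ _ _).2.2.1
  have d3 : ∀ i c d e : Fin 2, pd (Sum.inr i)
      (christoffel (blockMetric A B) (Sum.inr c) (Sum.inr d) (Sum.inr e)) p = 0 :=
    fun i c d e => d0 _ fun q hq => (hΓ q hq _ _ _).2.2.2.2.1
  have h1 := fun i j k => (hΓ p hp i j k).1
  have h3 := fun i j k => (hΓ p hp i j k).2.2.1
  have h4 := fun i j k => (hΓ p hp i j k).2.2.2.1
  have h5 := fun i j k => (hΓ p hp i j k).2.2.2.2.1
  have h6 := fun i j k => (hΓ p hp i j k).2.2.2.2.2.1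
  have h7 := fun i j k => (hΓ p hp i j k).2.2.2.2.2.2.1
  have h8 := fun i j k => (hΓ p hp i j k).2.2.2.2.2.2.2
  simp only [ricci, riemannUp, Fintype.sum_sum_type, d1, d2, d3, h1, h3, h4, h5, h6, h7, h8]
  simp only [← hx, Fin.sum_univ_two]
  ring
end TorusInvariant

/-! ### The fibre trace of the Ricci tensor -/

section Trace

variable {A B : (Fin 2 → ℝ) → Matrix (Fin 2) (Fin 2) ℝ}

theorem inv_apply_eq_adjugate_div (M : Matrix (Fin 2) (Fin 2) ℝ) (i j : Fin 2) :
    M⁻¹ i j = M.adjugate i j / M.det := by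
  rw [Matrix.inv_def, Ring.inverse_eq_inv', Matrix.smul_apply, smul_eq_mul, div_eq_inv_mul]

/-- Jacobi's formula for the derivative of the determinant. -/
theorem pd_det {x : Fin 2 → ℝ} (hA : ∀ i j, DifferentiableAt ℝ (fun y => A y i j) x)
    (i : Fin 2) :
    pd i (fun y => (A y).det) x = ∑ c, ∑ d, (A x).adjugate c d * pd i (fun y => A y d c) x := by
  simp only [Matrix.det_fin_two]
  rw [pd_sub ((hA _ _).fun_mul (hA _ _)) ((hA _ _).fun_mul (hA _ _)), pd_mul (hA _ _) (hA _ _),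
    pd_mul (hA _ _) (hA _ _)]
  simp [Matrix.adjugate_fin_two]
  ring

/-- This is `Γ^k_{ki} = ∂_i log √det A`. Symmetry is needed on a neighbourhood, so that the two
off-diagonal entries also have equal derivatives. -/
theorem christoffel_trace {x : Fin 2 → ℝ} (hA : ∀ i j, DifferentiableAt ℝ (fun y => A y i j) x)
    (hsymm : ∀ᶠ y in nhds x, (A y).IsSymm) (h0 : (A x).det ≠ 0) (i : Fin 2) :
    ∑ k, christoffel A k k i x = pd i (fun y => (A y).det) x / (2 * (A x).det) := by
  have h : ∀ k, pd k (fun y => A y 1 0) x = pd k (fun y => A y 0 1) x :=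
    pd_congr (hsymm.mono fun y hy => hy.apply 0 1)
  rw [pd_det hA]
  simp only [christoffel, inv_apply_eq_adjugate_div]
  fin_cases i <;> simp [Matrix.adjugate_fin_two, h, hsymm.self_of_nhds.apply 0 1] <;> field_simp <;> ring

/-- The trace of the fibre part of the Ricci tensor is `-r⁻¹ Δ r`, where `r` is the area density of
the fibres. -/
theorem laplaceBeltrami_eq_zero_of_ricci_eq_zero {U : Set (Fin 2 → ℝ)} (hU : IsOpen U)
    (hA : ∀ x ∈ U, ∀ i j, ContDiffAt ℝ ∞ (fun y => A y i j) x)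
    (hB : ∀ x ∈ U, ∀ i j, ContDiffAt ℝ ∞ (fun y => B y i j) x)
    (hAs : ∀ x ∈ U, (A x).IsSymm) (hBs : ∀ x ∈ U, (B x).IsSymm)
    (hA0 : ∀ x ∈ U, 0 < (A x).det) (hB0 : ∀ x ∈ U, 0 < (B x).det)
    {p : Fin 2 ⊕ Fin 2 → ℝ} (hp : moment p ∈ U)
    (hric : ∀ a b, ricci (blockMetric A B) (Sum.inr a) (Sum.inr b) p = 0) :
    laplaceBeltrami A (fun y => Real.sqrt (B y).det) (moment p) = 0 := by
  simp only [ricci_blockMetric hU hA hB (fun x hx => (hA0 x hx).ne') (fun x hx => (hB0 x hx).ne')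
    hp] at hric
  generalize moment p = x at *
  have dA : ∀ i j, DifferentiableAt ℝ (fun y => A y i j) x :=
    fun i j => (hA x hp i j).differentiableAt (by simp)
  have dB : ∀ i j, DifferentiableAt ℝ (fun y => B y i j) x :=
    fun i j => (hB x hp i j).differentiableAt (by simp)
  have ddB : ∀ i j k, DifferentiableAt ℝ (pd k fun y => B y i j) x :=
    fun i j k => (contDiffAt_pd (hB x hp i j) k).differentiableAt (by simp)
  set s : (Fin 2 → ℝ) → ℝ := fun y => Real.sqrt (A y).det with hs
  set r : (Fin 2 → ℝ) → ℝ := fun y => Real.sqrt (B y).det with hr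
  have cs : ContDiffAt ℝ ∞ s x := (contDiffAt_det (hA x hp)).sqrt (hA0 x hp).ne'
  have cr : ∀ y ∈ U, ContDiffAt ℝ ∞ r y :=
    fun y hy => (contDiffAt_det (hB y hy)).sqrt (hB0 y hy).ne'
  have ds : DifferentiableAt ℝ s x := cs.differentiableAt (by simp)
  have dr : ∀ y ∈ U, DifferentiableAt ℝ r y := fun y hy => (cr y hy).differentiableAt (by simp)
  have ddr : ∀ j, DifferentiableAt ℝ (pd j r) x :=
    fun j => (contDiffAt_pd (cr x hp) j).differentiableAt (by simp)
  have cE : ∀ i j, ContDiffAt ℝ ∞ (fun y => (A y)⁻¹ i j) x :=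
    contDiffAt_matrix_inv (hA x hp) (hA0 x hp).ne'
  have dE : ∀ i j, DifferentiableAt ℝ (fun y => (A y)⁻¹ i j) x :=
    fun i j => (cE i j).differentiableAt (by simp)
  have hU' : ∀ᶠ y in nhds x, y ∈ U := hU.mem_nhds hp
  have s0 : 0 < s x := Real.sqrt_pos.2 (hA0 x hp)
  have r0 : 0 < r x := Real.sqrt_pos.2 (hB0 x hp)
  have s2 : (A x).det = s x * s x := (Real.mul_self_sqrt (hA0 x hp).le).symm
  have r2 : ∀ y ∈ U, (B y).det = r y * r y := fun y hy => (Real.mul_self_sqrt (hB0 y hy).le).symm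
  -- Differentiating `det = (√det)²` avoids differentiating the square root itself.
  have sder : ∀ i, pd i (fun y => (A y).det) x = 2 * s x * pd i s x := by
    intro i
    have e : (fun y => (A y).det) =ᶠ[nhds x] fun y => s y * s y := by
      filter_upwards [hU'] with y hy using (Real.mul_self_sqrt (hA0 y hy).le).symm
    rw [pd_congr e, pd_mul ds ds]
    ring
  have rder : ∀ y ∈ U, ∀ i, pd i (fun y => (B y).det) y = 2 * (r y * pd i r y) := by
    intro y hy i
    have e : (fun y => (B y).det) =ᶠ[nhds y] fun y => r y * r y := by
      filter_upwards [hU.mem_nhds hy] with y hy using r2 y hy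
    rw [pd_congr e, pd_mul (dr y hy) (dr y hy)]
    ring
  have rder2 : ∀ i j, pd i (pd j (fun y => (B y).det)) x
      = 2 * (pd i r x * pd j r x + r x * pd i (pd j r) x) := by
    intro i j
    have e : pd j (fun y => (B y).det) =ᶠ[nhds x] fun y => 2 * (r y * pd j r y) := by
      filter_upwards [hU'] with y hy using rder y hy j
    rw [pd_congr e, pd_mul (differentiableAt_const _) ((dr x hp).fun_mul (ddr j)), pd_const,
      pd_mul (dr x hp) (ddr j)]
    ring
  have B10 : ∀ y ∈ U, ∀ i, pd i (fun y => B y 1 0) y = pd i (fun y => B y 0 1) y :=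
    fun y hy => pd_congr (by filter_upwards [hU.mem_nhds hy] with z hz using (hBs z hz).apply 0 1)
  have B10' : ∀ i j, pd i (pd j fun y => B y 1 0) x = pd i (pd j fun y => B y 0 1) x :=
    fun i j => pd_congr (by filter_upwards [hU'] with z hz using B10 z hz j) i
  have bdet : ∀ y ∈ U, ∀ i, pd i (fun y => (B y).det) y =
      pd i (fun y => B y 0 0) y * B y 1 1 + B y 0 0 * pd i (fun y => B y 1 1) y
        - 2 * (B y 0 1 * pd i (fun y => B y 0 1) y) := by
    intro y hy i
    rw [pd_det fun i j => (hB y hy i j).differentiableAt (by simp)]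
    simp [Matrix.adjugate_fin_two, B10 y hy, (hBs y hy).apply 0 1]
    ring
  -- Comparing this expansion of the second derivative with `rder2` expresses the second derivatives
  -- of `r` through those of the entries of `B`.
  have bdet2 : ∀ i j, pd i (pd j (fun y => (B y).det)) x =
      pd i (pd j fun y => B y 0 0) x * B x 1 1
        + pd j (fun y => B y 0 0) x * pd i (fun y => B y 1 1) x
        + pd i (fun y => B y 0 0) x * pd j (fun y => B y 1 1) x
        + B x 0 0 * pd i (pd j fun y => B y 1 1) x
        - 2 * (pd i (fun y => B y 0 1) x * pd j (fun y => B y 0 1) x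
          + B x 0 1 * pd i (pd j fun y => B y 0 1) x) := by
    intro i j
    have e : pd j (fun y => (B y).det) =ᶠ[nhds x] fun y =>
        pd j (fun y => B y 0 0) y * B y 1 1 + B y 0 0 * pd j (fun y => B y 1 1) y
          - 2 * (B y 0 1 * pd j (fun y => B y 0 1) y) := by
      filter_upwards [hU'] with y hy using bdet y hy j
    have e1 := (ddB 0 0 j).fun_mul (dB 1 1)
    have e2 := (dB 0 0).fun_mul (ddB 1 1 j)
    have e3 := (dB 0 1).fun_mul (ddB 0 1 j)
    rw [pd_congr e, pd_sub (e1.fun_add e2) ((differentiableAt_const _).fun_mul e3), pd_add e1 e2,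
      pd_mul (ddB 0 0 j) (dB 1 1), pd_mul (dB 0 0) (ddB 1 1 j),
      pd_mul (differentiableAt_const _) e3, pd_const, pd_mul (dB 0 1) (ddB 0 1 j)]
    ring
  have lap : laplaceBeltrami A r x = 1 / s x * ∑ i, ∑ j,
      (pd i s x * (A x)⁻¹ i j * pd j r x + s x * pd i (fun y => (A y)⁻¹ i j) x * pd j r x
        + s x * (A x)⁻¹ i j * pd i (pd j r) x) := by
    unfold laplaceBeltrami
    congr 1
    refine Finset.sum_congr rfl fun i _ => ?_
    have hW : ∀ j, DifferentiableAt ℝ (fun y => (A y)⁻¹ i j * pd j r y) x :=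
      fun j => (dE i j).fun_mul (ddr j)
    simp only [grad]
    rw [pd_mul ds (DifferentiableAt.fun_sum fun j _ => hW j), pd_sum _ fun j _ => hW j,
      Finset.mul_sum, Finset.mul_sum, ← Finset.sum_add_distrib]
    refine Finset.sum_congr rfl fun j _ => ?_
    rw [pd_mul (dE i j) (ddr j)]
    ring
  have tr : ∀ i, ∑ k, christoffel A k k i x = pd i s x / s x := by
    intro i
    rw [christoffel_trace dA (hU'.mono hAs) (hA0 x hp).ne', sder, s2]
    field_simp
  have trB : ∀ i, 1 / 2 * ∑ c, ∑ d, (B x)⁻¹ c d * pd i (fun y => B y c d) x = pd i r x / r x := by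
    intro i
    have h := bdet x hp i
    rw [rder x hp] at h
    simp only [inv_apply_eq_adjugate_div, r2 x hp]
    simp [Matrix.adjugate_fin_two, B10 x hp, (hBs x hp).apply 0 1]
    field_simp
    linarith
  rw [lap]
  simp only [tr, trB] at hric
  -- The trace identity already holds for each pair `i, j` separately. Tracing with the adjugate
  -- instead of `B⁻¹` multiplies by `det B = r²`, which, with the factor `-1/2` of the Ricci formula
  -- left out, produces the constant `2 r / s`.
  have key : ∀ i j : Fin 2, ∑ a, ∑ b, (B x).adjugate a b *
      (pd i (fun y => (A y)⁻¹ i j) x * pd j (fun y => B y a b) x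
        + (A x)⁻¹ i j * pd i (pd j (fun y => B y a b)) x
        + (pd i s x / s x + pd i r x / r x) * ((A x)⁻¹ i j * pd j (fun y => B y a b) x)
        - 1 / 2 * (A x)⁻¹ i j * ∑ c, ∑ d, (B x)⁻¹ c d
          * (pd j (fun y => B y a c) x * pd i (fun y => B y b d) x
            + pd i (fun y => B y a d) x * pd j (fun y => B y c b) x))
      = 2 * r x / s x *
      (pd i s x * (A x)⁻¹ i j * pd j r x + s x * pd i (fun y => (A y)⁻¹ i j) x * pd j r x
        + s x * (A x)⁻¹ i j * pd i (pd j r) x) := by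
    intro i j
    have hq := bdet x hp j
    have hi := bdet x hp i
    have hh := bdet2 i j
    have hβ := r2 x hp
    rw [rder x hp] at hq hi
    rw [rder2] at hh
    rw [Matrix.det_fin_two, (hBs x hp).apply 0 1] at hβ
    generalize (A x)⁻¹ i j = E, pd i (fun y => (A y)⁻¹ i j) x = E', pd i s x = si at *
    simp only [inv_apply_eq_adjugate_div, r2 x hp]
    simp only [Fin.sum_univ_two, Matrix.adjugate_fin_two, Matrix.of_apply, Matrix.cons_val_zero,
      Matrix.cons_val_one, Matrix.cons_val', Matrix.cons_val_fin_one, B10 x hp, B10',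
      (hBs x hp).apply 0 1]
    generalize pd i (pd j r) x = rij, pd i r x = ri, pd j r x = rj at *
    generalize pd i (pd j fun y => B y 0 0) x = h00, pd i (pd j fun y => B y 0 1) x = h01,
      pd i (pd j fun y => B y 1 1) x = h11 at *
    generalize pd i (fun y => B y 0 0) x = p00, pd i (fun y => B y 0 1) x = p01,
      pd i (fun y => B y 1 1) x = p11 at *
    generalize pd j (fun y => B y 0 0) x = q00, pd j (fun y => B y 0 1) x = q01,
      pd j (fun y => B y 1 1) x = q11 at *
    generalize B x 0 0 = b00, B x 0 1 = b01, B x 1 1 = b11, s x = t, r x = R at *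
    -- The polarised 2×2 identity `tr(MN) = tr M tr N - D(M, N)`, with `D` the polarised
    -- determinant, for `M = B⁻¹ ∂_i B` and `N = B⁻¹ ∂_j B`, cleared of denominators. Here `tr M = 2
    -- ∂_i r / r`, and the term `D` cancels the mixed first-order terms of `bdet2`.
    have hT : (b11 * q00 - b01 * q01) * (b11 * p00 - b01 * p01)
        + (b11 * q01 - b01 * q11) * (b00 * p01 - b01 * p00)
        + (b00 * q01 - b01 * q00) * (b11 * p01 - b01 * p11)
        + (b00 * q11 - b01 * q01) * (b00 * p11 - b01 * p01)
        = R ^ 2 * (4 * ri * rj - (p00 * q11 + p11 * q00 - 2 * p01 * q01)) := by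
      linear_combination (-(p00 * b11 + b00 * p11 - 2 * (b01 * p01))) * hq - 2 * (R * rj) * hi
        - (p00 * q11 + p11 * q00 - 2 * p01 * q01) * hβ
    linear_combination (norm := (field_simp; ring)) -(E' + (si / t + ri / R) * E) * hq - E * hh
      - E / (R * R) * hT
  have total : ∑ i, ∑ j, 2 * r x / s x *
      (pd i s x * (A x)⁻¹ i j * pd j r x + s x * pd i (fun y => (A y)⁻¹ i j) x * pd j r x
        + s x * (A x)⁻¹ i j * pd i (pd j r) x) = 0 := by
    -- Weights the four vanishing Ricci components by `c a b` and exchanges the order of summation.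
    have swap : ∀ (c : Matrix (Fin 2) (Fin 2) ℝ) (F : Fin 2 → Fin 2 → Fin 2 → Fin 2 → ℝ),
        (∀ a b, -(1 / 2) * ∑ i, ∑ j, F i j a b = 0) →
          ∑ i, ∑ j, ∑ a, ∑ b, c a b * F i j a b = 0 := by
      intro c F hF
      simp only [Fin.sum_univ_two] at hF ⊢
      linear_combination (-2) * (c 0 0 * hF 0 0 + c 0 1 * hF 0 1 + c 1 0 * hF 1 0 + c 1 1 * hF 1 1)
    simp only [← key]
    exact swap _ _ hric
  simp only [← Finset.mul_sum] at total
  rw [(mul_eq_zero.1 total).resolve_left (by positivity), mul_zero]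
end Trace

/-! ### The conformal toric metric and conformal covariance -/

section Toric

variable {u : (Fin 2 → ℝ) → ℝ} {x : Fin 2 → ℝ}

theorem contDiffAt_hess (hu : ContDiffAt ℝ ∞ u x) (i j : Fin 2) :
    ContDiffAt ℝ ∞ (fun y => hess u y i j) x :=
  contDiffAt_pd (contDiffAt_pd hu j) i

theorem contDiffAt_toricScal (hu : ContDiffAt ℝ ∞ u x) (h0 : (hess u x).det ≠ 0) :
    ContDiffAt ℝ ∞ (toricScal u) x := by
  have hx : moment (Sum.elim x 0) = x := rfl
  have hs : ContDiffAt ℝ ∞ (scal (toricMetric u)) (Sum.elim x 0) := by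
    refine contDiffAt_scal (fun i j => ?_) ?_
    · rcases i with i | i <;> rcases j with j | j
      · exact (contDiffAt_hess (x := moment (Sum.elim x 0)) hu i j).comp _
          contDiff_moment.contDiffAt
      · exact contDiffAt_const
      · exact contDiffAt_const
      · exact (contDiffAt_matrix_inv (x := moment (Sum.elim x 0)) (contDiffAt_hess hu) h0 i j).comp _
          contDiff_moment.contDiffAt
    -- The blocks are mutually inverse, so the determinant is 1.
    · rw [toricMetric, Matrix.det_fromBlocks_zero₂₁, hx, Matrix.det_nonsing_inv,
        Ring.inverse_eq_inv', mul_inv_cancel₀ h0]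
      exact one_ne_zero
  refine hs.comp x (contDiffAt_pi.2 fun i => ?_)
  rcases i with i | i
  · exact (contDiff_apply ℝ ℝ i).contDiffAt
  · exact contDiffAt_const

theorem contDiffAt_rho (hu : ContDiffAt ℝ ∞ u x) (h0 : 0 < (hess u x).det)
    (hs : toricScal u x ≠ 0) : ContDiffAt ℝ ∞ (rho u) x :=
  ((contDiffAt_det (contDiffAt_hess hu)).rpow_const_of_ne h0.ne').div
    ((contDiffAt_toricScal hu h0.ne').pow 2) (pow_ne_zero 2 hs)

theorem conformalMetric_toricMetric (u : (Fin 2 → ℝ) → ℝ) :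
    conformalMetric (toricMetric u) =
      blockMetric (fun x => (1 / toricScal u x ^ 2) • hess u x)
        (fun x => (1 / toricScal u x ^ 2) • (hess u x)⁻¹) := by
  funext p
  rw [conformalMetric, scal_toricMetric, toricMetric, blockMetric, Matrix.fromBlocks_smul,
    smul_zero]

/-- The area density of the fibres of `g_K / scal(g_K)²` is `ρ`. -/
theorem sqrt_det_conformal_inv_hess (h0 : 0 < (hess u x).det) :
    Real.sqrt ((1 / toricScal u x ^ 2) • (hess u x)⁻¹).det = rho u x := by
  rw [Matrix.det_smul, Matrix.det_nonsing_inv, Ring.inverse_eq_inv', Fintype.card_fin,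
    Real.sqrt_mul (by positivity), Real.sqrt_sq (by positivity), rho, Real.sqrt_inv,
    Real.sqrt_eq_rpow, Real.rpow_neg h0.le]
  ring

/-- In dimension two the Laplace-Beltrami operator is conformally covariant. -/
theorem laplaceBeltrami_smul {U : Set (Fin 2 → ℝ)} (hU : IsOpen U)
    {φ : (Fin 2 → ℝ) → ℝ} {g : (Fin 2 → ℝ) → Matrix (Fin 2) (Fin 2) ℝ}
    (hφ : ∀ y ∈ U, 0 < φ y) (hg : ∀ y ∈ U, 0 < (g y).det) (f : (Fin 2 → ℝ) → ℝ) (hx : x ∈ U) :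
    laplaceBeltrami (fun y => φ y • g y) f x = (φ x)⁻¹ * laplaceBeltrami g f x := by
  have hs : ∀ y ∈ U, Real.sqrt (φ y • g y).det = φ y * Real.sqrt (g y).det := fun y hy => by
    rw [Matrix.det_smul, Fintype.card_fin, Real.sqrt_mul (by positivity), Real.sqrt_sq (hφ y hy).le]
  have hi : ∀ y ∈ U, (φ y • g y)⁻¹ = (φ y)⁻¹ • (g y)⁻¹ := fun y hy => by
    have := hφ y hy
    apply Matrix.inv_eq_right_inv
    rw [Matrix.smul_mul, Matrix.mul_smul, smul_smul, mul_inv_cancel₀ this.ne', one_smul,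
      Matrix.mul_nonsing_inv _ (isUnit_iff_ne_zero.2 (hg y hy).ne')]
  -- The density scales by `φ` and the gradient by `φ⁻¹`, so the flux is unchanged near `x`; no
  -- regularity of `f` or `φ` is needed.
  have hF : ∀ i, (fun y => Real.sqrt (φ y • g y).det * grad (fun y => φ y • g y) f i y)
      =ᶠ[nhds x] fun y => Real.sqrt (g y).det * grad g f i y := fun i => by
    filter_upwards [hU.mem_nhds hx] with y hy
    have := (hφ y hy).ne'
    simp only [grad, hs y hy, hi y hy, Matrix.smul_apply, smul_eq_mul, Fin.sum_univ_two]
    field_simp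
  simp only [laplaceBeltrami, hs x hx, pd_congr (hF _)]
  rw [one_div, mul_inv, one_div, mul_assoc]

end Toric

end ToricKahler

/-! ### Harmonicity of `ρ` -/

open ToricKahler in
theorem mainTheorem4 (m : ℕ) (ν : Fin m → Fin 2 → ℝ) (c : Fin m → ℝ) (u : (Fin 2 → ℝ) → ℝ)
    (hu : ContDiffOn ℝ ∞ u (interior (ToricKahler.polytope ν c)))
    (hconv : ∀ x ∈ interior (ToricKahler.polytope ν c), (ToricKahler.hess u x).PosDef)
    (hext : ToricKahler.IsExtremalOn (ToricKahler.toricMetric u) (ToricKahler.toricJ u)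
      (ToricKahler.moment ⁻¹' interior (ToricKahler.polytope ν c)))
    (hbach : ToricKahler.IsBachFlatOn (ToricKahler.toricMetric u)
      (ToricKahler.moment ⁻¹' interior (ToricKahler.polytope ν c)))
    (hscal : ∀ p ∈ ToricKahler.moment ⁻¹' interior (ToricKahler.polytope ν c),
      ToricKahler.scal (ToricKahler.toricMetric u) p ≠ 0)
    (hric : ToricKahler.IsRicciFlatOn
      (ToricKahler.conformalMetric (ToricKahler.toricMetric u))
      (ToricKahler.moment ⁻¹' interior (ToricKahler.polytope ν c))) :
    ToricKahler.IsHarmonicOn (ToricKahler.realMetric u) (ToricKahler.rho u)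
      (interior (ToricKahler.polytope ν c)) := by
  generalize hUdef : interior (polytope ν c) = U at *
  have hU : IsOpen U := hUdef ▸ isOpen_interior
  have hsm : ∀ x ∈ U, ContDiffAt ℝ ∞ u x := fun x hx => hu.contDiffAt (hU.mem_nhds hx)
  have hdet : ∀ x ∈ U, 0 < (hess u x).det := fun x hx => (hconv x hx).det_pos
  have hs : ∀ x ∈ U, toricScal u x ≠ 0 := fun x hx => hscal (Sum.elim x 0) hx
  have hφ : ∀ x ∈ U, 0 < 1 / toricScal u x ^ 2 := fun x hx => by
    have := hs x hx
    positivity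
  have hsymm : ∀ x ∈ U, (hess u x).IsSymm := fun x hx => by
    have := (hconv x hx).isHermitian
    rwa [Matrix.IsHermitian, Matrix.conjTranspose_eq_transpose_of_trivial] at this
  have cφ : ∀ x ∈ U, ContDiffAt ℝ ∞ (fun y => 1 / toricScal u y ^ 2) x := fun x hx =>
    contDiffAt_const.div ((contDiffAt_toricScal (hsm x hx) (hdet x hx).ne').pow 2)
      (pow_ne_zero 2 (hs x hx))
  refine ⟨fun x hx => (contDiffAt_rho (hsm x hx) (hdet x hx) (hs x hx)).contDiffWithinAt,
    fun x hx => ?_⟩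
  -- Ricci-flatness is used only at the point of the fibre over `x` with zero angles.
  have h := laplaceBeltrami_eq_zero_of_ricci_eq_zero
    (A := fun x => (1 / toricScal u x ^ 2) • hess u x)
    (B := fun x => (1 / toricScal u x ^ 2) • (hess u x)⁻¹) (p := Sum.elim x 0) hU
    (fun y hy i j => (cφ y hy).mul (contDiffAt_hess (hsm y hy) i j))
    (fun y hy i j => (cφ y hy).mul
      (contDiffAt_matrix_inv (contDiffAt_hess (hsm y hy)) (hdet y hy).ne' i j))
    (fun y hy => (hsymm y hy).smul _) (fun y hy => (hsymm y hy).inv.smul _)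
    (fun y hy => by
      rw [Matrix.det_smul]
      exact mul_pos (pow_pos (hφ y hy) _) (hdet y hy))
    (fun y hy => by
      rw [Matrix.det_smul, Matrix.det_nonsing_inv, Ring.inverse_eq_inv']
      exact mul_pos (pow_pos (hφ y hy) _) (inv_pos.2 (hdet y hy)))
    hx (fun a b => by
      rw [← conformalMetric_toricMetric]
      exact hric _ hx _ _)
  change laplaceBeltrami _ _ x = 0 at h
  rw [laplaceBeltrami_smul hU hφ hdet _ hx] at h
  have h' := (mul_eq_zero.1 h).resolve_left (inv_ne_zero (hφ x hx).ne')
  -- The two expressions for the fibre density agree only on `U`. The Laplacian differentiates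
  -- twice, so equality of germs is needed at every `y` near `x`.
  have e : ∀ y ∈ U, rho u =ᶠ[nhds y]
      fun y => Real.sqrt ((1 / toricScal u y ^ 2) • (hess u y)⁻¹).det := fun y hy => by
    filter_upwards [hU.mem_nhds hy] with z hz using (sqrt_det_conformal_inv_hess (hdet z hz)).symm
  rw [← h']
  unfold laplaceBeltrami realMetric
  congr 1
  refine Finset.sum_congr rfl fun i _ => pd_congr ?_ i
  filter_upwards [hU.mem_nhds hx] with y hy
  simp only [grad, pd_congr (e y hy)]
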